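/- Let $d\in\{1,2,3\}$ and let $\Omega\subset\mathbb R^d$ be a bounded domain that is convex or has a $C^{1,1}$ boundary. Let $F\in C^2(\mathbb R)$, $f:=F'$, satisfy $f'\ge-\beta$ for some $\beta\in(0,\infty)$; if $d\in\{2,3\}$, assume also $|f(u)|\le c\,(|u|^p+1)$ for all $u\in\mathbb R$, with some $c\in(0,\infty)$ and some $p\in[1,\infty)$ if $d=2$, $p\in[1,5]$ if $d=3$. For $\varepsilon\in(0,1)$ let $\widehat A_\varepsilon\in W^{1,\infty}(\mathbb R)$ (bounded and Lipschitz continuous), and put $A_\varepsilon:=\varepsilon\widehat A_\varepsilon$. Assume that $A_\varepsilon\to A$ uniformly on $\mathbb R$ as $\varepsilon\searrow0$ for some $A\in W^{1,\infty}(\mathbb R)$, and that $A_*\le A_\varepsilon\le A^*$ for all $\varepsilon\in(0,1)$ with constants $A_*,A^*\in(0,\infty)$. Let $K_\varepsilon(s)=\int_0^sA_\varepsilon(t)\,dt$ and $K(s)=\int_0^sA(t)\,dt$. Fix $m\in\mathbb R$. Let $H^1_{av}(\Omega)=\{v\in H^1(\Omega):\int_\Omega v\,dx=0\}$ with the norm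 $\|\nabla v\|_{L^2(\Omega)}$, let $H'_{av}(\Omega)=\{\varphi\in (H^1(\Omega))^*:\langle\varphi,1\rangle=0\}$ with the dual norm $\|\varphi\|_{(H^1_{av})^*}=\sup\{|\langle\varphi,v\rangle|: v\in H^1_{av}(\Omega),\ \|\nabla v\|_{L^2}\le1\}$, and let $\mathcal H_m=(H'_{av}(\Omega)+m)\times L^2(\Omega)$ with the distance induced by the norm $(\|\varphi\|_{(H^1_{av})^*}^2+\|z\|_{L^2}^2)^{1/2}$ on $H'_{av}(\Omega)\times L^2(\Omega)$; functions $w\in L^2(\Omega)$ are regarded as elements of $(H^1(\Omega))^*$ through $v\mapsto\int_\Omega wv\,dx$. Let $$\mathcal E_{CH}(u)=\int_\Omega\Big(\tfrac12|\nabla u|^2+F(u)\Big)dx\in(-\infty,\infty],\qquad u\in H^1_{av}(\Omega)+m,$$ be the Ginzburg–Landau energy, and define for $(u,z)\in\mathcal H_m$ $$\mathcal E_\varepsilon(u,z)=\begin{cases}\mathcal E_{CH}(u)+\dfrac1{2\varepsilon^2}\displaystyle\int_\Omega(z-K_\varepsilon(u))^2dx&\text{if }u\in H^1_{av}(\Omega)+m,\\+\infty&\text{otherwise,}\end{cases}$$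 $$\mathcal E_0(u,z)=\begin{cases}\mathcal E_{CH}(u)&\text{if }u\in H^1_{av}(\Omega)+m\text{ and }z=K(u)\text{ a.e. in }\Omega,\\+\infty&\text{otherwise.}\end{cases}$$ Then $(\mathcal E_\varepsilon)_{\varepsilon\in(0,1)}$ $\Gamma$-converges to $\mathcal E_0$ in $\mathcal H_m$ as $\varepsilon\searrow0$, that is: 1. if $\mathbf u_\varepsilon\to\mathbf u$ in $\mathcal H_m$ as $\varepsilon\searrow0$, then $\mathcal E_0(\mathbf u)\le\liminf_{\varepsilon\to0}\mathcal E_\varepsilon(\mathbf u_\varepsilon)$; 2. for every $\mathbf u\in\mathcal H_m$ there are $\mathbf u_\varepsilon\in\mathcal H_m$ with $\mathbf u_\varepsilon\to\mathbf u$ in $\mathcal H_m$ and $\limsup_{\varepsilon\to0}\mathcal E_\varepsilon(\mathbf u_\varepsilon)\le\mathcal E_0(\mathbf u)$. Moreover, if $F\ge0$, then $\mathcal E_0$ takes values in $[0,\infty]$. -/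

import Mathlib

open Filter Topology

noncomputable section

open MeasureTheory Set
open scoped ENNReal NNReal ContDiff RealInnerProductSpace

namespace ViscoPhase

/-- Euclidean space of dimension `d`. -/
abbrev Euc (d : ℕ) : Type := EuclideanSpace ℝ (Fin d)

/-- A bounded domain: a bounded, nonempty, connected open set. -/
structure BoundedDomain (d : ℕ) where
  carrier : Set (Euc d)
  isOpen : IsOpen carrier
  isConnected : IsConnected carrier
  isBounded : Bornology.IsBounded carrier

/-- `Ω` has a `C^{1,1}` boundary: near each boundary point, in a suitable direction `e`, the set is
the strict epigraph of a `C¹` function with Lipschitz derivative of the variables orthogonal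
to `e`. -/
def HasC11Boundary {d : ℕ} (Ω : Set (Euc d)) : Prop :=
  ∀ x ∈ frontier Ω, ∃ (e : Euc d) (g : Euc d → ℝ) (r : ℝ), ‖e‖ = 1 ∧ 0 < r ∧
    (∀ (y : Euc d) (t : ℝ), g (y + t • e) = g y) ∧
    ContDiff ℝ 1 g ∧ (∃ L : ℝ≥0, LipschitzWith L (fderiv ℝ g)) ∧
    ∀ y ∈ Metric.ball x r, y ∈ Ω ↔ g y < ⟪e, y⟫

/-- `W^{1,∞}(ℝ)`: bounded and Lipschitz continuous functions. -/
def IsW1Inf (a : ℝ → ℝ) : Prop :=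
  (∃ C : ℝ, ∀ s, |a s| ≤ C) ∧ ∃ L : ℝ≥0, LipschitzWith L a

variable {d : ℕ}

/-- Lebesgue measure on `Ω`. -/
abbrev BoundedDomain.vol (Ω : BoundedDomain d) : Measure (Euc d) := volume.restrict Ω.carrier

instance (Ω : BoundedDomain d) : IsFiniteMeasure Ω.vol :=
  ⟨by simpa using Ω.isBounded.measure_lt_top⟩

/-- `L²(Ω)`. -/
abbrev L2 (Ω : BoundedDomain d) : Type := Lp ℝ 2 Ω.vol

/-- `L²(Ω; ℝ^d)`. -/
abbrev L2v (Ω : BoundedDomain d) : Type := Lp (Euc d) 2 Ω.vol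

/-- `φ` is a test function in `C_c^∞(Ω)`. -/
def IsTest (Ω : BoundedDomain d) (φ : Euc d → ℝ) : Prop :=
  ContDiff ℝ ∞ φ ∧ HasCompactSupport φ ∧ tsupport φ ⊆ Ω.carrier

/-- `g` is the weak gradient of `u` on `Ω`: `∫ u ∂_v φ = - ∫ φ (g · v)` for every test function `φ`
and every direction `v`. -/
def IsWeakGradient (Ω : BoundedDomain d) (u : L2 Ω) (g : L2v Ω) : Prop :=
  ∀ φ : Euc d → ℝ, IsTest Ω φ → ∀ v : Euc d,
    ∫ x, u x * fderiv ℝ φ x v ∂Ω.vol = -∫ x, φ x * ⟪g x, v⟫ ∂Ω.vol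

theorem IsTest.integrable_left {Ω : BoundedDomain d} {φ : Euc d → ℝ} (h : IsTest Ω φ) (u : L2 Ω)
    (v : Euc d) : Integrable (fun x => u x * fderiv ℝ φ x v) Ω.vol := by
  have hc : Continuous (fun x => fderiv ℝ φ x v) :=
    (h.1.continuous_fderiv (by simp)).clm_apply continuous_const
  have hs : HasCompactSupport (fun x => fderiv ℝ φ x v) := h.2.1.fderiv_apply (𝕜 := ℝ) v
  have hφ : MemLp (fun x => fderiv ℝ φ x v) 2 Ω.vol := hc.memLp_of_hasCompactSupport hs
  exact (Lp.memLp u).integrable_mul hφ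

theorem IsTest.integrable_right {Ω : BoundedDomain d} {φ : Euc d → ℝ} (h : IsTest Ω φ)
    (g : L2v Ω) (v : Euc d) : Integrable (fun x => φ x * ⟪g x, v⟫) Ω.vol := by
  have hg : MemLp (fun x => ⟪g x, v⟫) 2 Ω.vol := (Lp.memLp g).inner_const v
  have hφ : MemLp φ 2 Ω.vol := h.1.continuous.memLp_of_hasCompactSupport h.2.1
  exact hφ.integrable_mul hg

/-- The Sobolev space `H¹(Ω)`, realised as the space of pairs `(u, ∇u)` in `L² × L²`, with the
standard inner product `∫ u v + ∫ ∇u · ∇v`. -/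
def H1 (Ω : BoundedDomain d) : Submodule ℝ (WithLp 2 (L2 Ω × L2v Ω)) where
  carrier := {p | IsWeakGradient Ω p.fst p.snd}
  zero_mem' := by
    intro φ _ v
    have h1 : ∫ x, (0 : L2 Ω) x * fderiv ℝ φ x v ∂Ω.vol = 0 := by
      refine integral_eq_zero_of_ae ?_
      filter_upwards [Lp.coeFn_zero ℝ 2 Ω.vol] with x hx
      simp only [Pi.zero_apply]
      rw [hx]
      simp
    have h2 : ∫ x, φ x * ⟪(0 : L2v Ω) x, v⟫ ∂Ω.vol = 0 := by
      refine integral_eq_zero_of_ae ?_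
      filter_upwards [Lp.coeFn_zero (Euc d) 2 Ω.vol] with x hx
      simp only [Pi.zero_apply]
      rw [hx]
      simp
    simp only [WithLp.zero_fst, WithLp.zero_snd]
    rw [h1, h2, neg_zero]
  add_mem' := by
    intro p q hp hq φ hφ v
    have h1 : ∫ x, (p.fst + q.fst) x * fderiv ℝ φ x v ∂Ω.vol
        = ∫ x, p.fst x * fderiv ℝ φ x v + q.fst x * fderiv ℝ φ x v ∂Ω.vol := by
      refine integral_congr_ae ?_
      filter_upwards [Lp.coeFn_add p.fst q.fst] with x hx
      rw [hx, Pi.add_apply, add_mul]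
    have h2 : ∫ x, φ x * ⟪(p.snd + q.snd) x, v⟫ ∂Ω.vol
        = ∫ x, φ x * ⟪p.snd x, v⟫ + φ x * ⟪q.snd x, v⟫ ∂Ω.vol := by
      refine integral_congr_ae ?_
      filter_upwards [Lp.coeFn_add p.snd q.snd] with x hx
      rw [hx, Pi.add_apply, inner_add_left, mul_add]
    simp only [WithLp.add_fst, WithLp.add_snd]
    rw [h1, h2, integral_add (hφ.integrable_left _ _) (hφ.integrable_left _ _),
      integral_add (hφ.integrable_right _ _) (hφ.integrable_right _ _), hp φ hφ v, hq φ hφ v]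
    ring
  smul_mem' := by
    intro c p hp φ hφ v
    have h1 : ∫ x, (c • p.fst) x * fderiv ℝ φ x v ∂Ω.vol
        = ∫ x, c * (p.fst x * fderiv ℝ φ x v) ∂Ω.vol := by
      refine integral_congr_ae ?_
      filter_upwards [Lp.coeFn_smul c p.fst] with x hx
      rw [hx, Pi.smul_apply, smul_eq_mul, mul_assoc]
    have h2 : ∫ x, φ x * ⟪(c • p.snd) x, v⟫ ∂Ω.vol
        = ∫ x, c * (φ x * ⟪p.snd x, v⟫) ∂Ω.vol := by
      refine integral_congr_ae ?_
      filter_upwards [Lp.coeFn_smul c p.snd] with x hx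
      rw [hx, Pi.smul_apply, real_inner_smul_left]
      ring
    simp only [WithLp.smul_fst, WithLp.smul_snd]
    rw [h1, h2, integral_const_mul, integral_const_mul, hp φ hφ v]
    ring

/-- The function underlying an element of `H¹(Ω)`. -/
def H1fn {Ω : BoundedDomain d} (w : H1 Ω) : L2 Ω := (w : WithLp 2 (L2 Ω × L2v Ω)).fst

/-- The weak gradient of an element of `H¹(Ω)`. -/
def H1grad {Ω : BoundedDomain d} (w : H1 Ω) : L2v Ω := (w : WithLp 2 (L2 Ω × L2v Ω)).snd

/-- The constant function `1` in `H¹(Ω)`. -/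
def H1one (Ω : BoundedDomain d) : H1 Ω :=
  ⟨WithLp.toLp 2 (Lp.const 2 Ω.vol (1 : ℝ), (0 : L2v Ω)), by
    intro φ hφ v
    have hc : Continuous (fun x => fderiv ℝ φ x v) :=
      (hφ.1.continuous_fderiv (by simp)).clm_apply continuous_const
    have hs : HasCompactSupport (fun x => fderiv ℝ φ x v) := hφ.2.1.fderiv_apply (𝕜 := ℝ) v
    have h1 : ∫ x, (Lp.const 2 Ω.vol (1 : ℝ)) x * fderiv ℝ φ x v ∂Ω.vol = 0 := by
      have e1 : ∫ x, (Lp.const 2 Ω.vol (1 : ℝ)) x * fderiv ℝ φ x v ∂Ω.vol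
          = ∫ x, fderiv ℝ φ x v ∂Ω.vol := by
        refine integral_congr_ae ?_
        filter_upwards [Lp.coeFn_const (p := 2) (μ := Ω.vol) (1 : ℝ)] with x hx
        rw [hx]; simp
      have e2 : ∫ x, fderiv ℝ φ x v ∂Ω.vol = ∫ x, fderiv ℝ φ x v := by
        refine setIntegral_eq_integral_of_forall_compl_eq_zero ?_
        intro x hx
        have : fderiv ℝ φ x = 0 := by
          by_contra hne
          exact hx (hφ.2.2 (support_fderiv_subset ℝ hne))
        simp [this]
      have e3 : ∫ x, fderiv ℝ φ x v = 0 := by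
        have := integral_mul_fderiv_eq_neg_fderiv_mul_of_integrable (μ := volume)
          (f := fun _ : Euc d => (1 : ℝ)) (g := φ) (v := v) (by simp)
          (by simpa using hc.integrable_of_hasCompactSupport hs)
          (by simpa using hφ.1.continuous.integrable_of_hasCompactSupport hφ.2.1)
          (fun _ _ => by fun_prop) (fun x _ => hφ.1.differentiable (by simp) x)
        simpa using this
      rw [e1, e2, e3]
    have h2 : ∫ x, φ x * ⟪(0 : L2v Ω) x, v⟫ ∂Ω.vol = 0 := by
      refine integral_eq_zero_of_ae ?_
      filter_upwards [Lp.coeFn_zero (Euc d) 2 Ω.vol] with x hx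
      simp only [Pi.zero_apply]
      rw [hx]
      simp
    exact h1.trans (neg_eq_zero.mpr h2).symm⟩

/-- The dual space `(H¹(Ω))*`. -/
abbrev H1Dual (Ω : BoundedDomain d) : Type := StrongDual ℝ (H1 Ω)

/-- The embedding `L²(Ω) → (H¹(Ω))*`, `w ↦ (v ↦ ∫ w v)`. -/
def toDual {Ω : BoundedDomain d} (w : L2 Ω) : H1Dual Ω :=
  (innerSL ℝ w).comp ((WithLp.fstL 2 ℝ (L2 Ω) (L2v Ω)).comp (H1 Ω).subtypeL)

/-- `w` has mean value `m` over `Ω`; for `w ∈ H¹(Ω)` this says `w ∈ H¹_av(Ω) + m`. -/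
def HasMean {Ω : BoundedDomain d} (m : ℝ) (w : H1 Ω) : Prop :=
  ∫ x, H1fn w x ∂Ω.vol = m * Ω.vol.real univ

/-- The norm of `(H¹_av(Ω))*`, i.e. the dual of the norm `‖∇v‖_{L²}` on the space `H¹_av(Ω)` of
mean-free `H¹` functions. -/
def avDualNorm {Ω : BoundedDomain d} (φ : H1Dual Ω) : ℝ≥0∞ :=
  ⨆ (v : H1 Ω) (_ : HasMean 0 v) (_ : ‖H1grad v‖ ≤ 1), ‖φ v‖ₑ

/-- The affine state space `𝓗_m = (H'_av(Ω) + m) × L²(Ω)`, where `H'_av(Ω)` consists of the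
functionals in `(H¹(Ω))*` that vanish at the constant `1`, and `m` stands for the functional
`v ↦ ∫ m v`. -/
structure State (Ω : BoundedDomain d) (m : ℝ) where
  u : H1Dual Ω
  z : L2 Ω
  mass : (u - toDual (Lp.const 2 Ω.vol m)) (H1one Ω) = 0

/-- The distance of `𝓗_m`, induced by the Hilbert norm of `(H¹_av(Ω))* × L²(Ω)`. -/
def State.edistance {Ω : BoundedDomain d} {m : ℝ} (p q : State Ω m) : ℝ≥0∞ :=
  (avDualNorm (p.u - q.u) ^ 2 + ‖p.z - q.z‖ₑ ^ 2) ^ (1 / 2 : ℝ)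

/-- Convergence in `𝓗_m` of a family `(p_ε)` as `ε ↘ 0`. -/
def ConvergesTo {Ω : BoundedDomain d} {m : ℝ} (p : ℝ → State Ω m) (q : State Ω m) : Prop :=
  Tendsto (fun ε => (p ε).edistance q) (𝓝[>] 0) (𝓝 0)

/-- Γ-convergence in `𝓗_m` of a family of functionals `(E_ε)` to `E₀` as `ε ↘ 0`. -/
def GammaConverges {Ω : BoundedDomain d} {m : ℝ} (E : ℝ → State Ω m → EReal)
    (E₀ : State Ω m → EReal) : Prop :=
  (∀ (p : ℝ → State Ω m) (q : State Ω m), ConvergesTo p q →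
    E₀ q ≤ liminf (fun ε => E ε (p ε)) (𝓝[>] 0)) ∧
  (∀ q : State Ω m, ∃ p : ℝ → State Ω m, ConvergesTo p q ∧
    limsup (fun ε => E ε (p ε)) (𝓝[>] 0) ≤ E₀ q)

/-- The extended-valued Lebesgue integral `∫ f⁺ - ∫ f⁻`; below it is applied to functions `f`
for which `∫ f⁻` is finite. -/
def extIntegral {X : Type*} [MeasurableSpace X] (μ : Measure X) (f : X → ℝ) : EReal :=
  ((∫⁻ x, ENNReal.ofReal (f x) ∂μ : ℝ≥0∞) : EReal)
    - ((∫⁻ x, ENNReal.ofReal (-f x) ∂μ : ℝ≥0∞) : EReal)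

/-- The Ginzburg--Landau energy `∫ (½ |∇w|² + F(w))` of `w ∈ H¹(Ω)`. -/
def energyGL {Ω : BoundedDomain d} (F : ℝ → ℝ) (w : H1 Ω) : EReal :=
  extIntegral Ω.vol (fun x => 1 / 2 * ‖H1grad w x‖ ^ 2 + F (H1fn w x))

/-- The primitive `K` of `A` with `K(0) = 0`. -/
def primitive (A : ℝ → ℝ) (s : ℝ) : ℝ := ∫ t in (0 : ℝ)..s, A t

open Classical in
/-- The rescaled energy `E_ε(u,z) = ∫ (½|∇u|² + F(u)) + 1/(2ε²) ∫ (z - K_ε(u))²` on `𝓗_m`, with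
`Kε = K_ε`; it is `+∞` if `u` does not belong to `H¹_av(Ω) + m`. -/
def energyEps {Ω : BoundedDomain d} {m : ℝ} (F Kε : ℝ → ℝ) (ε : ℝ) (p : State Ω m) : EReal :=
  if h : ∃ w : H1 Ω, HasMean m w ∧ p.u = toDual (H1fn w) then
    energyGL F h.choose
      + ((1 / (2 * ε ^ 2) * ∫ x, (p.z x - Kε (H1fn h.choose x)) ^ 2 ∂Ω.vol : ℝ) : EReal)
  else ⊤

open Classical in
/-- The limit energy `E₀`: the Ginzburg--Landau energy of `u` if `u ∈ H¹_av(Ω) + m` and `z = K(u)`,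
and `+∞` otherwise. -/
def energyZero {Ω : BoundedDomain d} {m : ℝ} (F K : ℝ → ℝ) (p : State Ω m) : EReal :=
  if h : ∃ w : H1 Ω, HasMean m w ∧ p.u = toDual (H1fn w) ∧ ∀ᵐ x ∂Ω.vol, p.z x = K (H1fn w x) then
    energyGL F h.choose
  else ⊤

end ViscoPhase

end

/-!
Γ-convergence of the rescaled viscoelastic phase-separation energies.

The recovery sequence for `(u, K(u))` is `(u, K_ε(u))`: the coupling term vanishes identically, and
`|K_ε(s) - K(s)| ≤ sup |A_ε - A| · |s|` gives `K_ε(u) → K(u)` in `L²`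
(`tendsto_compLp`, `exists_recovery`).

For the lower bound take a sequence with `E_ε(u_ε, z_ε) ≤ c`. Since `F'' ≥ -β`, adding
`a + β s²` makes `F` nonnegative, so the energy is the Dirichlet energy plus a nonnegative potential
energy minus a continuous quadratic term in the `L²` norm (`energyGL_eq`). The quadratic term is
controlled by the interpolation `‖v‖² = ⟨v, v⟩ ≤ ‖v‖_* (‖∇v‖ + 1)` for mean-free `v`
(`norm_sub_sq_le`): with the dual norm bounded it grows only linearly in `‖∇u‖`, which bounds
the gradients (`exists_grad_bound`). The same interpolation, now with dual norms tending to zero,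
makes `u_ε` Cauchy in `L²`, so that neither a compact embedding nor the Poincaré inequality is
needed; the gradients converge weakly along an ultrafilter by the Banach–Alaoglu theorem, and the
limit functional is represented by the `H¹` limit (`State.exists_limit`). The bound on
`ε⁻² ∫ (z_ε - K_ε(u_ε))²` forces `z = K(u)`, and lower semicontinuity of the norm together with
Fatou's lemma concludes (`energyGL_le_of_tendsto`, `energyZero_le_of_seq`).

The values of the functionals do not depend on the `H¹` representative chosen in their definition,
because the functional induced by `w` determines `w`, and a weak gradient is unique
(`H1.eq_of_toDual_eq`).
-/

namespace ViscoPhase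

open MeasureTheory Set
open scoped ENNReal NNReal ContDiff RealInnerProductSpace

variable {d : ℕ} {Ω : BoundedDomain d} {m : ℝ}

/-! ### Weak gradients and the Sobolev space -/

theorem BoundedDomain.vol_real_pos (Ω : BoundedDomain d) : 0 < Ω.vol.real univ := by
  rw [measureReal_restrict_apply_univ]
  exact ENNReal.toReal_pos (Ω.isOpen.measure_pos volume Ω.isConnected.nonempty).ne'
    Ω.isBounded.measure_lt_top.ne

theorem IsWeakGradient.unique {u : L2 Ω} {g g' : L2v Ω} (h : IsWeakGradient Ω u g)
    (h' : IsWeakGradient Ω u g') : g = g' := by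
  have hint : Integrable (fun x => g x - g' x) Ω.vol :=
    ((Lp.memLp g).sub (Lp.memLp g')).integrable (by norm_num)
  have key : ∀ᵐ x ∂Ω.vol, x ∈ Ω.carrier → g x - g' x = 0 := by
    refine Ω.isOpen.ae_eq_zero_of_integral_contDiff_smul_eq_zero
      (hint.locallyIntegrable.locallyIntegrableOn _) fun φ h1 h2 h3 => ?_
    have hφ : IsTest Ω φ := ⟨h1, h2, h3⟩
    have hs : Integrable (fun x => φ x • (g x - g' x)) Ω.vol := by
      obtain ⟨C, hC⟩ := h2.exists_bound_of_continuous h1.continuous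
      exact hint.bdd_smul C h1.continuous.aestronglyMeasurable (Eventually.of_forall hC)
    refine ext_inner_right ℝ fun v => ?_
    rw [inner_zero_left, real_inner_comm, ← integral_inner hs v]
    have e : ∀ x, ⟪v, φ x • (g x - g' x)⟫ = φ x * ⟪g x, v⟫ - φ x * ⟪g' x, v⟫ := fun x => by
      rw [real_inner_comm, real_inner_smul_left, inner_sub_left, mul_sub]
    simp_rw [e]
    rw [integral_sub (hφ.integrable_right g v) (hφ.integrable_right g' v)]
    have := h φ hφ v
    have := h' φ hφ v
    linarith
  refine Lp.ext ?_
  filter_upwards [key, ae_restrict_mem Ω.isOpen.measurableSet] with x hx hm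
  exact sub_eq_zero.1 (hx hm)

/-- The graph of the weak gradient is closed for strong convergence of the functions and weak
convergence of the gradients. -/
theorem IsWeakGradient.of_tendsto {ι : Type*} {l : Filter ι} [l.NeBot] {u : ι → L2 Ω}
    {g : ι → L2v Ω} {u' : L2 Ω} {g' : L2v Ω} (h : ∀ i, IsWeakGradient Ω (u i) (g i))
    (hu : Tendsto u l (𝓝 u')) (hg : ∀ ψ : L2v Ω, Tendsto (fun i => ⟪g i, ψ⟫) l (𝓝 ⟪g', ψ⟫)) :
    IsWeakGradient Ω u' g' := by
  intro φ hφ v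
  have hc : Continuous (fun x => fderiv ℝ φ x v) :=
    (hφ.1.continuous_fderiv (by simp)).clm_apply continuous_const
  have hs : HasCompactSupport (fun x => fderiv ℝ φ x v) := hφ.2.1.fderiv_apply (𝕜 := ℝ) v
  have h1 : MemLp (fun x => fderiv ℝ φ x v) 2 Ω.vol := hc.memLp_of_hasCompactSupport hs
  have h2 : MemLp (fun x => φ x • v) 2 Ω.vol :=
    (hφ.1.continuous.smul continuous_const).memLp_of_hasCompactSupport hφ.2.1.smul_right
  have e1 : ∀ a : L2 Ω, ∫ x, a x * fderiv ℝ φ x v ∂Ω.vol = ⟪a, h1.toLp⟫ := fun a => by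
    rw [L2.inner_def]
    refine integral_congr_ae ?_
    filter_upwards [h1.coeFn_toLp] with x hx
    rw [hx]
    simp [mul_comm]
  have e2 : ∀ b : L2v Ω, ∫ x, φ x * ⟪b x, v⟫ ∂Ω.vol = ⟪b, h2.toLp⟫ := fun b => by
    rw [L2.inner_def]
    refine integral_congr_ae ?_
    filter_upwards [h2.coeFn_toLp] with x hx
    rw [hx, real_inner_smul_right]
  rw [e1, e2]
  refine tendsto_nhds_unique (hu.inner tendsto_const_nhds) ?_
  refine ((hg h2.toLp).neg).congr fun i => ?_
  rw [← e1, ← e2, h i φ hφ v]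

theorem toDual_apply (u : L2 Ω) (v : H1 Ω) : toDual u v = ⟪u, H1fn v⟫ := rfl

theorem toDual_sub (u u' : L2 Ω) : toDual (u - u') = toDual u - toDual u' := by
  ext v
  simp only [toDual_apply, sub_apply, inner_sub_left]

theorem H1fn_sub (v w : H1 Ω) : H1fn (v - w) = H1fn v - H1fn w := rfl

theorem H1grad_sub (v w : H1 Ω) : H1grad (v - w) = H1grad v - H1grad w := rfl

theorem H1fn_smul (c : ℝ) (v : H1 Ω) : H1fn (c • v) = c • H1fn v := rfl

theorem H1grad_smul (c : ℝ) (v : H1 Ω) : H1grad (c • v) = c • H1grad v := rfl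

theorem H1fn_one : H1fn (H1one Ω) = Lp.const 2 Ω.vol (1 : ℝ) := rfl

/-- An `H¹` function is determined by the functional that it induces on `H¹(Ω)`. -/
theorem H1.eq_of_toDual_eq {v w : H1 Ω} (h : toDual (H1fn v) = toDual (H1fn w)) : v = w := by
  have h0 : H1fn v = H1fn w := by
    have : toDual (H1fn v - H1fn w) (v - w) = 0 := by rw [toDual_sub, h, sub_self]; rfl
    rw [toDual_apply, H1fn_sub, inner_self_eq_zero] at this
    exact sub_eq_zero.1 this
  have hw : IsWeakGradient Ω (H1fn v) (H1grad w) := by rw [h0]; exact w.2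
  have h1 : H1grad v = H1grad w := IsWeakGradient.unique v.2 hw
  exact Subtype.ext ((WithLp.ofLp_injective 2) (Prod.ext h0 h1))

/-! ### Mean values and the dual norm -/

theorem inner_const (u : L2 Ω) (c : ℝ) :
    ⟪u, Lp.const 2 Ω.vol c⟫ = c * ∫ x, u x ∂Ω.vol := by
  rw [L2.inner_def, ← integral_const_mul]
  refine integral_congr_ae ?_
  filter_upwards [Lp.coeFn_const (p := 2) (μ := Ω.vol) c] with x hx
  rw [hx]
  simp

theorem hasMean_iff {w : H1 Ω} : HasMean m w ↔ ⟪H1fn w, H1fn (H1one Ω)⟫ = m * Ω.vol.real univ := by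
  rw [H1fn_one, inner_const, one_mul, HasMean]

theorem HasMean.sub {v w : H1 Ω} {a b : ℝ} (hv : HasMean a v) (hw : HasMean b w) :
    HasMean (a - b) (v - w) := by
  rw [hasMean_iff] at *
  rw [H1fn_sub, inner_sub_left, hv, hw, sub_mul]

theorem HasMean.smul {v : H1 Ω} {a : ℝ} (c : ℝ) (hv : HasMean a v) : HasMean (c * a) (c • v) := by
  rw [hasMean_iff] at *
  rw [H1fn_smul, real_inner_smul_left, hv, mul_assoc]

theorem hasMean_one : HasMean 1 (H1one Ω) := by
  rw [hasMean_iff, H1fn_one, inner_const, one_mul]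
  rw [integral_congr_ae (Lp.coeFn_const (p := 2) (μ := Ω.vol) (1 : ℝ))]
  simp

theorem exists_hasMean (w : H1 Ω) : ∃ a, HasMean a w :=
  ⟨(∫ x, H1fn w x ∂Ω.vol) / Ω.vol.real univ, by
    rw [HasMean, div_mul_cancel₀ _ Ω.vol_real_pos.ne']⟩

/-- The mass constraint of a state, read as the value of its functional at `1`. -/
theorem State.apply_one (q : State Ω m) : q.u (H1one Ω) = m * Ω.vol.real univ := by
  have h := q.mass
  rw [sub_apply, sub_eq_zero] at h
  rw [h, toDual_apply, real_inner_comm, inner_const]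
  have : HasMean 1 (H1one Ω) := hasMean_one
  rw [HasMean] at this
  rw [this, one_mul]

/-- The duality estimate for `(H¹_av)*` and `H¹_av`. The summand `1` makes the estimate a direct
consequence of scaling also where the gradient vanishes. -/
theorem abs_apply_le {φ : H1Dual Ω} {N : ℝ} (hN0 : 0 ≤ N)
    (hN : avDualNorm φ ≤ ENNReal.ofReal N) {v : H1 Ω} (hv : HasMean 0 v) :
    |φ v| ≤ N * (‖H1grad v‖ + 1) := by
  set s := ‖H1grad v‖ + 1 with hs
  have hs0 : 0 < s := by positivity
  have h1 : HasMean 0 (s⁻¹ • v) := by simpa using hv.smul s⁻¹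
  have h2 : ‖H1grad (s⁻¹ • v)‖ ≤ 1 := by
    rw [H1grad_smul, norm_smul, Real.norm_of_nonneg (by positivity), inv_mul_le_iff₀ hs0, hs]
    linarith
  have h3 : ‖φ (s⁻¹ • v)‖ₑ ≤ ENNReal.ofReal N :=
    (le_iSup_of_le (f := fun w : H1 Ω => ⨆ (_ : HasMean 0 w) (_ : ‖H1grad w‖ ≤ 1), ‖φ w‖ₑ)
      (s⁻¹ • v) (le_iSup₂_of_le h1 h2 le_rfl)).trans hN
  rw [map_smul, smul_eq_mul, Real.enorm_eq_ofReal_abs] at h3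
  rw [ENNReal.ofReal_le_ofReal_iff hN0, abs_mul, abs_of_pos (inv_pos.2 hs0),
    inv_mul_le_iff₀ hs0] at h3
  linarith

theorem avDualNorm_sub_le (φ ψ : H1Dual Ω) :
    avDualNorm (φ - ψ) ≤ avDualNorm φ + avDualNorm ψ := by
  refine iSup_le fun v => iSup_le fun hv => iSup_le fun hg => ?_
  rw [sub_apply]
  refine (enorm_sub_le).trans (add_le_add ?_ ?_)
  · exact le_iSup_of_le v (le_iSup_of_le hv (le_iSup_of_le hg le_rfl))
  · exact le_iSup_of_le v (le_iSup_of_le hv (le_iSup_of_le hg le_rfl))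

theorem avDualNorm_zero : avDualNorm (0 : H1Dual Ω) = 0 := by
  simp [avDualNorm]

/-! ### The Ginzburg--Landau energy and its lower semicontinuity -/

/-- If `h` compensates the negative part of `f`, the extended integral of `e + f` splits. -/
theorem extIntegral_add {X : Type*} [MeasurableSpace X] {μ : Measure X} {e f h : X → ℝ}
    (he : Integrable e μ) (he0 : ∀ x, 0 ≤ e x) (hf : AEMeasurable f μ) (hh : Integrable h μ)
    (hh0 : ∀ x, 0 ≤ h x) (hfh : ∀ x, 0 ≤ f x + h x) :
    extIntegral μ (fun x => e x + f x) =
      ((∫ x, e x ∂μ : ℝ) : EReal) + ((∫⁻ x, ENNReal.ofReal (f x + h x) ∂μ : ℝ≥0∞) : EReal)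
        - ((∫ x, h x ∂μ : ℝ) : EReal) := by
  set P := ∫⁻ x, ENNReal.ofReal (e x + f x) ∂μ with hP
  set N := ∫⁻ x, ENNReal.ofReal (-(e x + f x)) ∂μ with hN
  set G := ∫⁻ x, ENNReal.ofReal (f x + h x) ∂μ with hG
  have hE : ∫⁻ x, ENNReal.ofReal (e x) ∂μ = ENNReal.ofReal (∫ x, e x ∂μ) :=
    (ofReal_integral_eq_lintegral_ofReal he (Eventually.of_forall he0)).symm
  have hH : ∫⁻ x, ENNReal.ofReal (h x) ∂μ = ENNReal.ofReal (∫ x, h x ∂μ) :=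
    (ofReal_integral_eq_lintegral_ofReal hh (Eventually.of_forall hh0)).symm
  have hNfin : N ≠ ⊤ := by
    refine ne_top_of_le_ne_top (b := ∫⁻ x, ENNReal.ofReal (h x) ∂μ) (by rw [hH]; simp) ?_
    refine lintegral_mono fun x => ENNReal.ofReal_le_ofReal ?_
    linarith [he0 x, hfh x]
  have hbal : ENNReal.ofReal (∫ x, e x ∂μ) + G + N = P + ENNReal.ofReal (∫ x, h x ∂μ) := by
    rw [← hE, ← hH, hG, hN, hP, ← lintegral_add_left' he.aemeasurable.ennreal_ofReal,
      ← lintegral_add_right' (g := fun x => ENNReal.ofReal (-(e x + f x))) _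
        (he.aemeasurable.add hf).neg.ennreal_ofReal,
      ← lintegral_add_right' _ hh.aemeasurable.ennreal_ofReal]
    refine lintegral_congr fun x => ?_
    rw [← ENNReal.ofReal_add (he0 x) (hfh x)]
    rcases le_total 0 (e x + f x) with hx | hx
    · rw [ENNReal.ofReal_of_nonpos (neg_nonpos.2 hx), ← ENNReal.ofReal_add hx (hh0 x), add_zero,
        add_assoc]
    · rw [ENNReal.ofReal_of_nonpos hx, zero_add, ← ENNReal.ofReal_add
        (add_nonneg (he0 x) (hfh x)) (neg_nonneg.2 hx)]
      congr 1
      ring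
  have hes : 0 ≤ ∫ x, e x ∂μ := integral_nonneg he0
  have hhs : 0 ≤ ∫ x, h x ∂μ := integral_nonneg hh0
  change ((P : ℝ≥0∞) : EReal) - ((N : ℝ≥0∞) : EReal) = _
  clear_value P N G
  lift N to ℝ≥0 using hNfin
  rcases eq_or_ne G ⊤ with rfl | hGfin
  · have : P = ⊤ := by
      by_contra hcon
      lift P to ℝ≥0 using hcon
      simp at hbal
      exact ENNReal.add_ne_top.2 ⟨ENNReal.coe_ne_top, ENNReal.ofReal_ne_top⟩ hbal.symm
    subst this
    rfl
  · lift G to ℝ≥0 using hGfin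
    have : P ≠ ⊤ := by
      rintro rfl
      rw [top_add] at hbal
      exact ENNReal.add_ne_top.2 ⟨ENNReal.add_ne_top.2 ⟨ENNReal.ofReal_ne_top,
        ENNReal.coe_ne_top⟩, ENNReal.coe_ne_top⟩ hbal
    lift P to ℝ≥0 using this
    have hb := congrArg ENNReal.toReal hbal
    rw [ENNReal.toReal_add (by simp) (by simp), ENNReal.toReal_add (by simp) (by simp),
      ENNReal.toReal_add (by simp) (by simp), ENNReal.toReal_ofReal hes,
      ENNReal.toReal_ofReal hhs] at hb
    simp only [ENNReal.coe_toReal] at hb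
    change ((P : ℝ) : EReal) - ((N : ℝ) : EReal) = _ + ((G : ℝ) : EReal) - _
    norm_cast
    linarith

/-- A function with second derivative at least `-β` lies above a downward parabola. -/
theorem exists_neg_quadratic_le {F : ℝ → ℝ} (hF : ContDiff ℝ 2 F) {β : ℝ} (hβ : 0 < β)
    (hFβ : ∀ s, -β ≤ deriv (deriv F) s) : ∃ a, 0 ≤ a ∧ ∀ s, 0 ≤ F s + (a + β * s ^ 2) := by
  have hd : Differentiable ℝ F := hF.differentiable (by simp)
  have hd' : Differentiable ℝ (deriv F) := by
    have : ContDiff ℝ (1 + 1) F := by simpa [one_add_one_eq_two] using hF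
    exact (contDiff_succ_iff_deriv.1 this).2.2.differentiable (by simp)
  have hder : ∀ s, HasDerivAt (fun s => F s + β / 2 * s ^ 2) (deriv F s + β * s) s := fun s => by
    have := (hd s).hasDerivAt.add ((hasDerivAt_pow 2 s).const_mul (β / 2))
    have e : β / 2 * (((2 : ℕ) : ℝ) * s ^ (2 - 1)) = β * s := by
      push_cast
      ring
    rwa [e] at this
  have hmono : Monotone fun s => deriv F s + β * s := by
    refine monotone_of_deriv_nonneg (by fun_prop) fun s => ?_
    have : HasDerivAt (fun s => deriv F s + β * s) (deriv (deriv F) s + β * 1) s :=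
      (hd' s).hasDerivAt.add ((hasDerivAt_id s).const_mul β)
    rw [this.deriv]
    linarith [hFβ s]
  have hconv : ConvexOn ℝ univ fun s => F s + β / 2 * s ^ 2 := by
    refine Monotone.convexOn_univ_of_deriv (fun s => (hder s).differentiableAt) ?_
    rwa [show deriv (fun s => F s + β / 2 * s ^ 2) = fun s => deriv F s + β * s from
      funext fun s => (hder s).deriv]
  have htan : ∀ s, F 0 + deriv F 0 * s ≤ F s + β / 2 * s ^ 2 := fun s => by
    rcases lt_trichotomy s 0 with hs | rfl | hs
    · have := hconv.slope_le_of_hasDerivAt (mem_univ s) (mem_univ 0) hs (hder 0)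
      rw [slope_def_field, div_le_iff₀ (by linarith)] at this
      simp at this
      linarith
    · simp
    · have := hconv.le_slope_of_hasDerivAt (mem_univ 0) (mem_univ s) hs (hder 0)
      rw [slope_def_field, le_div_iff₀ (by linarith)] at this
      simp at this
      linarith
  refine ⟨|F 0| + (deriv F 0) ^ 2 / (2 * β), by positivity, fun s => ?_⟩
  have h1 := htan s
  have h2 : 0 ≤ (deriv F 0) ^ 2 / (2 * β) + deriv F 0 * s + β / 2 * s ^ 2 := by
    have : (deriv F 0) ^ 2 / (2 * β) + deriv F 0 * s + β / 2 * s ^ 2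
        = (deriv F 0 + β * s) ^ 2 / (2 * β) := by
      field_simp
      ring
    rw [this]
    positivity
  linarith [neg_abs_le (F 0)]

theorem integral_sq_eq_norm_sq {X E : Type*} [MeasurableSpace X] {μ : Measure X}
    [NormedAddCommGroup E] [InnerProductSpace ℝ E] (u : Lp E 2 μ) :
    ∫ x, ‖u x‖ ^ 2 ∂μ = ‖u‖ ^ 2 := by
  rw [← real_inner_self_eq_norm_sq, L2.inner_def]
  simp_rw [real_inner_self_eq_norm_sq]

/-- A bounded sequence in a Hilbert space converges weakly along some ultrafilter. -/
theorem exists_weak_limit {H : Type*} [NormedAddCommGroup H] [InnerProductSpace ℝ H]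
    [CompleteSpace H] {g : ℕ → H} {M : ℝ} (hM : ∀ n, ‖g n‖ ≤ M) :
    ∃ (U : Ultrafilter ℕ) (g' : H), (U : Filter ℕ) ≤ atTop ∧
      ∀ ψ, Tendsto (fun n => ⟪g n, ψ⟫) U (𝓝 ⟪g', ψ⟫) := by
  let T : ℕ → WeakDual ℝ H := fun n => StrongDual.toWeakDual (InnerProductSpace.toDual ℝ H (g n))
  have hT : ∀ n, T n ∈ WeakDual.toStrongDual ⁻¹' Metric.closedBall (0 : StrongDual ℝ H) M :=
    fun n => by
      rw [mem_preimage, mem_closedBall_zero_iff]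
      exact ((InnerProductSpace.toDual ℝ H).norm_map (g n)).trans_le (hM n)
  let U : Ultrafilter ℕ := Ultrafilter.of atTop
  obtain ⟨ℓ, -, hℓ⟩ := (WeakDual.isCompact_closedBall (𝕜 := ℝ) (0 : StrongDual ℝ H) M
    ).ultrafilter_le_nhds (U.map T) (le_principal_iff.2 (mem_map.2 (Eventually.of_forall hT)))
  refine ⟨U, (InnerProductSpace.toDual ℝ H).symm (WeakDual.toStrongDual ℓ), Ultrafilter.of_le _,
    fun ψ => ?_⟩
  rw [InnerProductSpace.toDual_symm_apply]
  exact ((WeakDual.eval_continuous ψ).tendsto ℓ).comp (show Tendsto T U (𝓝 ℓ) from hℓ)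

/-- The energy splits into the Dirichlet energy, the nonnegative part of the potential energy that
remains after a quadratic function is added to `F`, and the integral of that quadratic function. -/
theorem energyGL_eq {F : ℝ → ℝ} (hF : Continuous F) {a β : ℝ} (ha : 0 ≤ a) (hβ : 0 ≤ β)
    (hFa : ∀ s, 0 ≤ F s + (a + β * s ^ 2)) (w : H1 Ω) :
    energyGL F w = ((1 / 2 * ‖H1grad w‖ ^ 2 : ℝ) : EReal)
      + ((∫⁻ x, ENNReal.ofReal (F (H1fn w x) + (a + β * H1fn w x ^ 2)) ∂Ω.vol : ℝ≥0∞) : EReal)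
      - ((a * Ω.vol.real univ + β * ‖H1fn w‖ ^ 2 : ℝ) : EReal) := by
  have h1 : Integrable (fun x => 1 / 2 * ‖H1grad w x‖ ^ 2) Ω.vol :=
    ((Lp.memLp (H1grad w)).integrable_norm_pow two_ne_zero).const_mul _
  have h2 : Integrable (fun x => H1fn w x ^ 2) Ω.vol := (Lp.memLp (H1fn w)).integrable_sq
  have h3 : Integrable (fun x => a + β * H1fn w x ^ 2) Ω.vol :=
    (integrable_const a).add (h2.const_mul β)
  rw [energyGL, extIntegral_add (e := fun x => 1 / 2 * ‖H1grad w x‖ ^ 2)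
    (f := fun x => F (H1fn w x)) (h := fun x => a + β * H1fn w x ^ 2) h1 (fun x => by positivity)
    (hF.measurable.comp_aemeasurable (Lp.aestronglyMeasurable (H1fn w)).aemeasurable) h3
    (fun x => by positivity) (fun x => hFa _), integral_const_mul, integral_sq_eq_norm_sq,
    integral_add (integrable_const a) (h2.const_mul β), integral_const_mul, integral_const,
    smul_eq_mul, mul_comm _ a]
  have : ∫ x, H1fn w x ^ 2 ∂Ω.vol = ‖H1fn w‖ ^ 2 := by
    rw [← integral_sq_eq_norm_sq]
    simp
  rw [this]

/-- A bound on the energy and a coupling term `r`, rewritten as an inequality between reals; `t` is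
the potential energy shifted to be nonnegative, which the bound makes finite. -/
theorem energyGL_add_coe_le {F : ℝ → ℝ} (hF : Continuous F) {a β : ℝ} (ha : 0 ≤ a) (hβ : 0 ≤ β)
    (hFa : ∀ s, 0 ≤ F s + (a + β * s ^ 2)) {w : H1 Ω} {r c : ℝ}
    (h : energyGL F w + (r : EReal) ≤ c) :
    ∃ t, 0 ≤ t ∧
      ∫⁻ x, ENNReal.ofReal (F (H1fn w x) + (a + β * H1fn w x ^ 2)) ∂Ω.vol = ENNReal.ofReal t ∧
      1 / 2 * ‖H1grad w‖ ^ 2 + t + r ≤ c + (a * Ω.vol.real univ + β * ‖H1fn w‖ ^ 2) := by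
  rw [energyGL_eq hF ha hβ hFa] at h
  generalize (∫⁻ x, ENNReal.ofReal (F (H1fn w x) + (a + β * H1fn w x ^ 2)) ∂Ω.vol) = I at h ⊢
  rcases eq_or_ne I ⊤ with rfl | hI
  · rw [EReal.coe_ennreal_top, EReal.coe_add_top, EReal.top_sub_coe, EReal.top_add_coe,
      top_le_iff] at h
    exact absurd h (EReal.coe_ne_top c)
  · lift I to ℝ≥0 using hI
    refine ⟨I, I.2, by simp, ?_⟩
    change _ + ((I : ℝ) : EReal) - _ + _ ≤ _ at h
    norm_cast at h
    linarith

theorem energyGL_le {F : ℝ → ℝ} (hF : Continuous F) {a β : ℝ} (ha : 0 ≤ a) (hβ : 0 ≤ β)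
    (hFa : ∀ s, 0 ≤ F s + (a + β * s ^ 2)) {w : H1 Ω} {t c : ℝ} (ht : 0 ≤ t)
    (hI : ∫⁻ x, ENNReal.ofReal (F (H1fn w x) + (a + β * H1fn w x ^ 2)) ∂Ω.vol ≤ ENNReal.ofReal t)
    (h : 1 / 2 * ‖H1grad w‖ ^ 2 + t ≤ c + (a * Ω.vol.real univ + β * ‖H1fn w‖ ^ 2)) :
    energyGL F w ≤ c := by
  rw [energyGL_eq hF ha hβ hFa]
  generalize (∫⁻ x, ENNReal.ofReal (F (H1fn w x) + (a + β * H1fn w x ^ 2)) ∂Ω.vol) = I at hI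
  lift I to ℝ≥0 using ne_top_of_le_ne_top ENNReal.ofReal_ne_top hI
  have hI' : (I : ℝ) ≤ t := by
    have := ENNReal.toReal_mono ENNReal.ofReal_ne_top hI
    rwa [ENNReal.toReal_ofReal ht] at this
  change _ + ((I : ℝ) : EReal) - _ ≤ _
  norm_cast
  linarith

/-- Fatou's lemma, as lower semicontinuity of an integral functional on `L²`. -/
theorem lowerSemicontinuous_lintegral_comp {X : Type*} [MeasurableSpace X] {μ : Measure X}
    {G : ℝ → ℝ} (hG : Continuous G) :
    LowerSemicontinuous fun u : Lp ℝ 2 μ => ∫⁻ x, ENNReal.ofReal (G (u x)) ∂μ := by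
  refine lowerSemicontinuous_iff_isClosed_preimage.2 fun y => IsSeqClosed.isClosed ?_
  intro u u' hu hlim
  obtain ⟨ns, -, hae⟩ := (tendstoInMeasure_of_tendsto_Lp hlim).exists_seq_tendsto_ae
  calc ∫⁻ x, ENNReal.ofReal (G (u' x)) ∂μ
      = ∫⁻ x, liminf (fun n => ENNReal.ofReal (G (u (ns n) x))) atTop ∂μ := by
        refine lintegral_congr_ae ?_
        filter_upwards [hae] with x hx
        exact ((ENNReal.continuous_ofReal.comp hG).tendsto _ |>.comp hx).liminf_eq.symm
    _ ≤ liminf (fun n => ∫⁻ x, ENNReal.ofReal (G (u (ns n) x)) ∂μ) atTop :=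
        lintegral_liminf_le' fun n => (hG.measurable.comp_aemeasurable
          (Lp.aestronglyMeasurable (u (ns n))).aemeasurable).ennreal_ofReal
    _ ≤ y := liminf_le_of_le (by isBoundedDefault) fun b hb => by
        obtain ⟨n, hn⟩ := hb.exists
        exact hn.trans (hu (ns n))

/-- The energy is lower semicontinuous for strong convergence of the functions and weak
convergence of the gradients. -/
theorem energyGL_le_of_tendsto {F : ℝ → ℝ} (hF : Continuous F) {a β : ℝ} (ha : 0 ≤ a)
    (hβ : 0 ≤ β) (hFa : ∀ s, 0 ≤ F s + (a + β * s ^ 2)) {ι : Type*} {l : Filter ι} [l.NeBot]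
    {w : ι → H1 Ω} {w' : H1 Ω} {c : ℝ} (hc : ∀ i, energyGL F (w i) ≤ c)
    (hw : Tendsto (fun i => H1fn (w i)) l (𝓝 (H1fn w')))
    (hg : ∀ ψ, Tendsto (fun i => ⟪H1grad (w i), ψ⟫) l (𝓝 ⟪H1grad w', ψ⟫)) :
    energyGL F w' ≤ c := by
  have h : ∀ i, ∃ t, 0 ≤ t ∧
      ∫⁻ x, ENNReal.ofReal (F (H1fn (w i) x) + (a + β * H1fn (w i) x ^ 2)) ∂Ω.vol
        = ENNReal.ofReal t ∧
      1 / 2 * ‖H1grad (w i)‖ ^ 2 + t + 0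
        ≤ c + (a * Ω.vol.real univ + β * ‖H1fn (w i)‖ ^ 2) := fun i =>
    energyGL_add_coe_le hF ha hβ hFa (by simpa using hc i)
  choose t ht0 htI hts using h
  set g' := H1grad w'
  -- The weak lower semicontinuity of the norm enters as `½|g|² ≥ ⟪g, g'⟫ - ½|g'|²`.
  let T : ι → ℝ := fun i => c + (a * Ω.vol.real univ + β * ‖H1fn (w i)‖ ^ 2)
    - ⟪H1grad (w i), g'⟫ + 1 / 2 * ‖g'‖ ^ 2
  have htT : ∀ i, t i ≤ T i := fun i => by
    have h1 : 0 ≤ ‖H1grad (w i) - g'‖ ^ 2 := by positivity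
    rw [norm_sub_sq_real] at h1
    have := hts i
    simp only [T]
    linarith
  have hT : Tendsto T l (𝓝 (c + (a * Ω.vol.real univ + β * ‖H1fn w'‖ ^ 2)
      - ⟪g', g'⟫ + 1 / 2 * ‖g'‖ ^ 2)) :=
    ((((hw.norm.pow 2).const_mul β).const_add _ |>.const_add c).sub (hg g')).add_const _
  refine energyGL_le hF ha hβ hFa
    (ge_of_tendsto hT (Eventually.of_forall fun i => (ht0 i).trans (htT i))) ?_
    (le_of_eq (by rw [real_inner_self_eq_norm_sq]; ring))
  refine le_of_forall_lt_imp_le_of_dense fun y hy => ?_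
  have hlsc := lowerSemicontinuous_lintegral_comp (μ := Ω.vol)
    (G := fun s => F s + (a + β * s ^ 2)) (by fun_prop) (H1fn w') y hy
  refine ge_of_tendsto (ENNReal.tendsto_ofReal hT) ?_
  filter_upwards [hw.eventually hlsc] with i hi
  exact hi.le.trans ((htI i).trans_le (ENNReal.ofReal_le_ofReal (htT i)))

/-! ### Convergence in the dual norm and gradient bounds -/

/-- Interpolation between `(H¹_av)*` and `H¹_av`: two functions with the same mean that are close
in the dual norm to a common functional are close in `L²`. -/
theorem norm_sub_sq_le {φ : H1Dual Ω} {v w : H1 Ω} (hv : HasMean m v) (hw : HasMean m w)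
    {N N' : ℝ} (hN0 : 0 ≤ N) (hN0' : 0 ≤ N')
    (hN : avDualNorm (toDual (H1fn v) - φ) ≤ ENNReal.ofReal N)
    (hN' : avDualNorm (toDual (H1fn w) - φ) ≤ ENNReal.ofReal N') :
    ‖H1fn v - H1fn w‖ ^ 2 ≤ (N + N') * (‖H1grad v‖ + ‖H1grad w‖ + 1) := by
  have hle : avDualNorm (toDual (H1fn v - H1fn w)) ≤ ENNReal.ofReal (N + N') := by
    rw [ENNReal.ofReal_add hN0 hN0', toDual_sub,
      ← sub_sub_sub_cancel_right (toDual (H1fn v)) (toDual (H1fn w)) φ]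
    exact (avDualNorm_sub_le _ _).trans (add_le_add hN hN')
  have h0 : HasMean 0 (v - w) := by simpa using hv.sub hw
  have h1 := abs_apply_le (add_nonneg hN0 hN0') hle h0
  rw [toDual_apply, H1fn_sub, real_inner_self_eq_norm_sq, H1grad_sub,
    abs_of_nonneg (by positivity)] at h1
  exact h1.trans (mul_le_mul_of_nonneg_left (by linarith [norm_sub_le (H1grad v) (H1grad w)])
    (by positivity))

/-- A sequence in `H¹_av + m` that is bounded in the dual norm and has bounded energy has bounded
gradients, although `F` may tend to `-∞` quadratically: by interpolation the square of the `L²`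
norm grows at most linearly in the norm of the gradient. -/
theorem exists_grad_bound {F : ℝ → ℝ} (hF : Continuous F) {a β : ℝ} (ha : 0 ≤ a)
    (hβ : 0 ≤ β) (hFa : ∀ s, 0 ≤ F s + (a + β * s ^ 2)) {φ : H1Dual Ω} {w : ℕ → H1 Ω}
    (hw : ∀ n, HasMean m (w n)) {N c : ℝ} (hN0 : 0 ≤ N)
    (hN : ∀ n, avDualNorm (toDual (H1fn (w n)) - φ) ≤ ENNReal.ofReal N)
    (hc : ∀ n, energyGL F (w n) ≤ c) :
    ∃ M, ∀ n, ‖H1grad (w n)‖ ≤ M := by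
  set W := ‖H1fn (w 0)‖
  set g := ‖H1grad (w 0)‖
  set P := |c| + a * Ω.vol.real univ + β * (2 * W ^ 2 + 4 * N * (g + 1)) with hP
  set Q := β * (4 * N) with hQ
  have hP0 : 0 ≤ P := by positivity
  have hQ0 : 0 ≤ Q := by positivity
  -- `½ b² ≤ P + Q b` with `P, Q ≥ 0` implies `b ≤ 1 + 2 P + 2 Q`.
  refine ⟨1 + 2 * P + 2 * Q, fun n => ?_⟩
  set b := ‖H1grad (w n)‖
  have hb0 : 0 ≤ b := norm_nonneg _
  obtain ⟨t, ht0, -, ht⟩ := energyGL_add_coe_le hF ha hβ hFa (r := 0) (by simpa using hc n)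
  have h1 := norm_sub_sq_le (hw n) (hw 0) hN0 hN0 (hN n) (hN 0)
  have h2 : ‖H1fn (w n)‖ ≤ ‖H1fn (w n) - H1fn (w 0)‖ + W := norm_le_norm_sub_add _ _
  have h3 : ‖H1fn (w n)‖ ^ 2 ≤ 2 * W ^ 2 + 4 * N * (g + 1) + 4 * N * b := by
    have := pow_le_pow_left₀ (norm_nonneg _) h2 2
    have := sq_nonneg (‖H1fn (w n) - H1fn (w 0)‖ - W)
    nlinarith
  have h4 : 1 / 2 * b ^ 2 ≤ P + Q * b := by
    have := mul_le_mul_of_nonneg_left h3 hβ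
    rw [hP, hQ]
    linarith [le_abs_self c]
  by_contra! hcon
  nlinarith [mul_pos (show 0 < b by linarith) (show 0 < b - (1 + 2 * P + 2 * Q) by linarith)]

/-- The mass constraint fixes the functional of a state at `1`, so that its values on mean-free
functions determine it. -/
theorem State.u_eq_toDual (q : State Ω m) {w : H1 Ω} (hw : HasMean m w)
    (h : ∀ v : H1 Ω, HasMean 0 v → q.u v = toDual (H1fn w) v) : q.u = toDual (H1fn w) := by
  have h1 : q.u (H1one Ω) = toDual (H1fn w) (H1one Ω) := by
    rw [q.apply_one, toDual_apply, hasMean_iff.1 hw]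
  ext v
  obtain ⟨b, hb⟩ := exists_hasMean v
  have h2 : HasMean 0 (v - b • H1one Ω) := by simpa using hb.sub (hasMean_one.smul b)
  have := h _ h2
  rw [map_sub, map_sub, map_smul, map_smul, h1] at this
  exact sub_left_inj.1 this

/-- Compactness: under a gradient bound, convergence in the dual norm to a state improves to strong
`L²` convergence and, along an ultrafilter, weak convergence of the gradients. No compact embedding
is needed, because interpolation makes the sequence Cauchy in `L²`. -/
theorem State.exists_limit (q : State Ω m) {w : ℕ → H1 Ω} (hw : ∀ n, HasMean m (w n))
    {N : ℕ → ℝ} (hN0 : ∀ n, 0 ≤ N n)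
    (hN : ∀ n, avDualNorm (toDual (H1fn (w n)) - q.u) ≤ ENNReal.ofReal (N n))
    (hNlim : Tendsto N atTop (𝓝 0)) {M : ℝ} (hM : ∀ n, ‖H1grad (w n)‖ ≤ M) :
    ∃ w' : H1 Ω, HasMean m w' ∧ q.u = toDual (H1fn w') ∧
      Tendsto (fun n => H1fn (w n)) atTop (𝓝 (H1fn w')) ∧
      ∃ U : Ultrafilter ℕ, (U : Filter ℕ) ≤ atTop ∧
        ∀ ψ, Tendsto (fun n => ⟪H1grad (w n), ψ⟫) U (𝓝 ⟪H1grad w', ψ⟫) := by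
  have hM0 : 0 ≤ M := (norm_nonneg _).trans (hM 0)
  have hcau : CauchySeq fun n => H1fn (w n) := by
    refine Metric.cauchySeq_iff'.2 fun δ hδ => ?_
    obtain ⟨n₀, hn₀⟩ := eventually_atTop.1
      (hNlim.eventually (gt_mem_nhds (show 0 < δ ^ 2 / (2 * (2 * M + 1)) by positivity)))
    refine ⟨n₀, fun n hn => ?_⟩
    rw [dist_eq_norm]
    refine lt_of_pow_lt_pow_left₀ 2 hδ.le ?_
    calc ‖H1fn (w n) - H1fn (w n₀)‖ ^ 2
        ≤ (N n + N n₀) * (‖H1grad (w n)‖ + ‖H1grad (w n₀)‖ + 1) :=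
          norm_sub_sq_le (hw n) (hw n₀) (hN0 n) (hN0 n₀) (hN n) (hN n₀)
      _ ≤ (N n + N n₀) * (2 * M + 1) := by
          have := hN0 n
          have := hN0 n₀
          gcongr
          linarith [hM n, hM n₀]
      _ < (δ ^ 2 / (2 * (2 * M + 1)) + δ ^ 2 / (2 * (2 * M + 1))) * (2 * M + 1) := by
          have := hn₀ n hn
          have := hn₀ n₀ le_rfl
          gcongr
      _ = δ ^ 2 := by
          field_simp
          ring
  obtain ⟨u, hu⟩ := cauchySeq_tendsto_of_complete hcau
  obtain ⟨U, g, hU, hg⟩ := exists_weak_limit hM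
  have hwg : IsWeakGradient Ω u g :=
    IsWeakGradient.of_tendsto (fun n => (w n).2) (hu.mono_left hU) hg
  let w' : H1 Ω := ⟨WithLp.toLp 2 (u, g), hwg⟩
  have hu' : Tendsto (fun n => H1fn (w n)) atTop (𝓝 (H1fn w')) := hu
  have hmean : HasMean m w' := by
    rw [hasMean_iff]
    refine tendsto_nhds_unique (hu'.inner tendsto_const_nhds) ?_
    exact tendsto_const_nhds.congr fun n => (hasMean_iff.1 (hw n)).symm
  refine ⟨w', hmean, q.u_eq_toDual hmean fun v hv => ?_, hu', U, hU, hg⟩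
  have h1 : Tendsto (fun n => toDual (H1fn (w n)) v) atTop (𝓝 (toDual (H1fn w') v)) :=
    hu'.inner tendsto_const_nhds
  have h2 : Tendsto (fun n => (toDual (H1fn (w n)) - q.u) v) atTop (𝓝 0) := by
    refine squeeze_zero_norm (fun n => abs_apply_le (hN0 n) (hN n) hv) ?_
    simpa using hNlim.mul_const (‖H1grad v‖ + 1)
  have h3 := h1.sub h2
  simp only [sub_apply, sub_sub_cancel, sub_zero] at h3
  exact tendsto_nhds_unique tendsto_const_nhds h3

/-! ### Primitives as superposition operators on `L²` -/

theorem primitive_zero (a : ℝ → ℝ) : primitive a 0 = 0 :=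
  intervalIntegral.integral_same

theorem IsW1Inf.intervalIntegrable {a : ℝ → ℝ} (ha : IsW1Inf a) (s t : ℝ) :
    IntervalIntegrable a volume s t := by
  obtain ⟨-, L, hL⟩ := ha
  exact hL.continuous.intervalIntegrable s t

theorem lipschitzWith_const_mul_primitive {a : ℝ → ℝ} (ha : IsW1Inf a) {c : ℝ} {L : ℝ≥0}
    (hL : ∀ s, |c * a s| ≤ L) : LipschitzWith L fun s => c * primitive a s := by
  refine LipschitzWith.of_dist_le_mul fun s t => ?_
  have : c * primitive a s - c * primitive a t = ∫ x in t..s, c * a x := by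
    rw [← mul_sub, primitive, primitive, intervalIntegral.integral_const_mul,
      intervalIntegral.integral_interval_sub_left (ha.intervalIntegrable _ _)
        (ha.intervalIntegrable _ _)]
  rw [Real.dist_eq, Real.dist_eq, this]
  exact intervalIntegral.norm_integral_le_of_norm_le_const (f := fun x => c * a x)
    fun x _ => hL x

theorem abs_const_mul_primitive_sub_le {a b : ℝ → ℝ} (ha : IsW1Inf a) (hb : IsW1Inf b) {c δ : ℝ}
    (hδ : ∀ s, |c * a s - b s| ≤ δ) (s : ℝ) : |c * primitive a s - primitive b s| ≤ δ * |s| := by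
  have : c * primitive a s - primitive b s = ∫ x in (0 : ℝ)..s, c * a x - b x := by
    rw [intervalIntegral.integral_sub ((ha.intervalIntegrable _ _).const_mul c)
      (hb.intervalIntegrable _ _), intervalIntegral.integral_const_mul, primitive, primitive]
  rw [this]
  simpa using intervalIntegral.norm_integral_le_of_norm_le_const (a := 0) (b := s)
    (f := fun x => c * a x - b x) fun x _ => hδ x

/-- Superposition operators on `L²` of Lipschitz functions converge pointwise if the functions
converge relative to `|s|`. -/
theorem tendsto_compLp {X ι : Type*} [MeasurableSpace X] {μ : Measure X} {l : Filter ι}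
    {k : ι → ℝ → ℝ} {K : ℝ → ℝ} {L : ι → ℝ≥0} {L' : ℝ≥0} (hk : ∀ i, LipschitzWith (L i) (k i))
    (hk0 : ∀ i, k i 0 = 0) (hK : LipschitzWith L' K) (hK0 : K 0 = 0)
    (h : ∀ δ > 0, ∀ᶠ i in l, ∀ s, |k i s - K s| ≤ δ * |s|) (u : Lp ℝ 2 μ) :
    Tendsto (fun i => (hk i).compLp (hk0 i) u) l (𝓝 (hK.compLp hK0 u)) := by
  refine Metric.tendsto_nhds.2 fun δ hδ => ?_
  filter_upwards [h (δ / (‖u‖ + 1)) (by positivity)] with i hi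
  rw [dist_eq_norm]
  have : ‖(hk i).compLp (hk0 i) u - hK.compLp hK0 u‖ ≤ δ / (‖u‖ + 1) * ‖u‖ := by
    refine Lp.norm_le_mul_norm_of_ae_le_mul ?_
    filter_upwards [Lp.coeFn_sub ((hk i).compLp (hk0 i) u) (hK.compLp hK0 u),
      (hk i).coeFn_compLp (hk0 i) u, hK.coeFn_compLp hK0 u] with x h1 h2 h3
    rw [h1, Pi.sub_apply, h2, h3]
    exact hi (u x)
  refine this.trans_lt ?_
  rw [div_mul_eq_mul_div, div_lt_iff₀ (by positivity)]
  nlinarith [norm_nonneg u]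

theorem integral_sub_sq_eq {X : Type*} [MeasurableSpace X] {μ : Measure X} {k : ℝ → ℝ} {L : ℝ≥0}
    (hk : LipschitzWith L k) (hk0 : k 0 = 0) (z u : Lp ℝ 2 μ) :
    ∫ x, (z x - k (u x)) ^ 2 ∂μ = ‖z - hk.compLp hk0 u‖ ^ 2 := by
  rw [← integral_sq_eq_norm_sq]
  refine integral_congr_ae ?_
  filter_upwards [Lp.coeFn_sub z (hk.compLp hk0 u), hk.coeFn_compLp hk0 u] with x h1 h2
  rw [h1, Pi.sub_apply, h2, Real.norm_eq_abs, sq_abs, Function.comp_apply]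

/-! ### The functionals and the metric on the state space -/

/-- The choice of the `H¹` function in the definition of `energyEps` is immaterial. -/
theorem energyEps_eq {F k : ℝ → ℝ} {ε : ℝ} {p : State Ω m} {w : H1 Ω} (hw : HasMean m w)
    (hp : p.u = toDual (H1fn w)) :
    energyEps F k ε p = energyGL F w
      + ((1 / (2 * ε ^ 2) * ∫ x, (p.z x - k (H1fn w x)) ^ 2 ∂Ω.vol : ℝ) : EReal) := by
  have h : ∃ w : H1 Ω, HasMean m w ∧ p.u = toDual (H1fn w) := ⟨w, hw, hp⟩
  rw [energyEps, dif_pos h, H1.eq_of_toDual_eq (h.choose_spec.2.symm.trans hp)]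

theorem energyZero_eq {F K : ℝ → ℝ} {p : State Ω m} {w : H1 Ω} (hw : HasMean m w)
    (hp : p.u = toDual (H1fn w)) (hz : ∀ᵐ x ∂Ω.vol, p.z x = K (H1fn w x)) :
    energyZero F K p = energyGL F w := by
  have h : ∃ w : H1 Ω, HasMean m w ∧ p.u = toDual (H1fn w) ∧
      ∀ᵐ x ∂Ω.vol, p.z x = K (H1fn w x) := ⟨w, hw, hp, hz⟩
  rw [energyZero, dif_pos h, H1.eq_of_toDual_eq (h.choose_spec.2.1.symm.trans hp)]

theorem energyZero_nonneg {F K : ℝ → ℝ} (hF : ∀ s, 0 ≤ F s) (p : State Ω m) :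
    0 ≤ energyZero F K p := by
  rw [energyZero]
  split_ifs with h
  · rw [energyGL, extIntegral]
    have : ∀ x, ENNReal.ofReal (-(1 / 2 * ‖H1grad h.choose x‖ ^ 2 + F (H1fn h.choose x))) = 0 :=
      fun x => ENNReal.ofReal_of_nonpos
        (neg_nonpos.2 (add_nonneg (by positivity) (hF _)))
    simp only [this, lintegral_zero, EReal.coe_ennreal_zero, sub_zero]
    exact EReal.coe_ennreal_nonneg _
  · exact le_top

theorem avDualNorm_le_edistance (p q : State Ω m) : avDualNorm (p.u - q.u) ≤ p.edistance q := by
  rw [State.edistance, one_div, ENNReal.le_rpow_inv_iff two_pos, ENNReal.rpow_two]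
  exact le_self_add

theorem enorm_sub_le_edistance (p q : State Ω m) : ‖p.z - q.z‖ₑ ≤ p.edistance q := by
  rw [State.edistance, one_div, ENNReal.le_rpow_inv_iff two_pos, ENNReal.rpow_two]
  exact le_add_self

theorem edistance_of_u_eq {p q : State Ω m} (h : p.u = q.u) : p.edistance q = ‖p.z - q.z‖ₑ := by
  rw [State.edistance, h, sub_self, avDualNorm_zero, zero_pow two_ne_zero, zero_add,
    ← ENNReal.rpow_two, ← ENNReal.rpow_mul]
  simp

/-! ### The lower bound and the recovery sequence -/

/-- The lower bound along a sequence: bounded energies force the limit state to lie on the graph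
`z = K(u)`, and the Ginzburg--Landau energy is lower semicontinuous. -/
theorem energyZero_le_of_seq {F : ℝ → ℝ} (hF : Continuous F) {a β : ℝ} (ha : 0 ≤ a)
    (hβ : 0 ≤ β) (hFa : ∀ s, 0 ≤ F s + (a + β * s ^ 2)) {p : ℕ → State Ω m} {q : State Ω m}
    (hpq : Tendsto (fun n => (p n).edistance q) atTop (𝓝 0))
    (hfin : ∀ n, avDualNorm ((p n).u - q.u) ≠ ⊤) {ε : ℕ → ℝ} (hε0 : ∀ n, 0 < ε n)
    (hε : Tendsto ε atTop (𝓝 0)) {k : ℕ → ℝ → ℝ} {K : ℝ → ℝ} {L L' : ℝ≥0}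
    (hk : ∀ n, LipschitzWith L (k n)) (hk0 : ∀ n, k n 0 = 0) (hK : LipschitzWith L' K)
    (hK0 : K 0 = 0) (hkK : ∀ δ > 0, ∀ᶠ n in atTop, ∀ s, |k n s - K s| ≤ δ * |s|) {c : ℝ}
    (hc : ∀ n, energyEps F (k n) (ε n) (p n) ≤ c) :
    energyZero F K q ≤ c := by
  have hex : ∀ n, ∃ w : H1 Ω, HasMean m w ∧ (p n).u = toDual (H1fn w) := fun n => by
    by_contra hcon
    have := hc n
    rw [energyEps, dif_neg hcon, top_le_iff] at this
    exact EReal.coe_ne_top c this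
  choose w hw hpw using hex
  have hEn : ∀ n, energyGL F (w n)
      + ((1 / (2 * ε n ^ 2) * ‖(p n).z - (hk n).compLp (hk0 n) (H1fn (w n))‖ ^ 2 : ℝ) : EReal)
        ≤ c := fun n => by
    have := hc n
    rwa [energyEps_eq (hw n) (hpw n), integral_sub_sq_eq (hk n) (hk0 n)] at this
  have hGL : ∀ n, energyGL F (w n) ≤ c := fun n => by
    refine le_trans ?_ (hEn n)
    refine le_add_of_nonneg_right ?_
    exact_mod_cast (by positivity : (0 : ℝ) ≤ 1 / (2 * ε n ^ 2)
      * ‖(p n).z - (hk n).compLp (hk0 n) (H1fn (w n))‖ ^ 2)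
  let N : ℕ → ℝ := fun n => (avDualNorm ((p n).u - q.u)).toReal
  have hN0 : ∀ n, 0 ≤ N n := fun n => ENNReal.toReal_nonneg
  have hN : ∀ n, avDualNorm (toDual (H1fn (w n)) - q.u) ≤ ENNReal.ofReal (N n) := fun n => by
    rw [← hpw n, ENNReal.ofReal_toReal (hfin n)]
  have hNlim : Tendsto N atTop (𝓝 0) := by
    rw [← ENNReal.toReal_zero]
    exact (ENNReal.tendsto_toReal ENNReal.zero_ne_top).comp
      (tendsto_of_tendsto_of_tendsto_of_le_of_le tendsto_const_nhds hpq (fun _ => zero_le)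
        fun n => avDualNorm_le_edistance (p n) q)
  obtain ⟨B, hB⟩ := hNlim.bddAbove_range
  have hNB : ∀ n, N n ≤ B := fun n => hB (mem_range_self n)
  obtain ⟨M, hM⟩ := exists_grad_bound hF ha hβ hFa hw ((hN0 0).trans (hNB 0))
    (fun n => (hN n).trans (ENNReal.ofReal_le_ofReal (hNB n))) hGL
  obtain ⟨w', hw', hqw', hlim, U, hU, hUg⟩ := q.exists_limit hw hN0 hN hNlim hM
  have hz : Tendsto (fun n => (p n).z) atTop (𝓝 q.z) := by
    rw [tendsto_iff_edist_tendsto_0]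
    simp_rw [edist_eq_enorm_sub]
    exact tendsto_of_tendsto_of_tendsto_of_le_of_le tendsto_const_nhds hpq (fun _ => zero_le)
      fun n => enorm_sub_le_edistance (p n) q
  have hkw : Tendsto (fun n => (hk n).compLp (hk0 n) (H1fn (w n))) atTop
      (𝓝 (hK.compLp hK0 (H1fn w'))) := by
    have h1 := tendsto_compLp hk hk0 hK hK0 hkK (H1fn w')
    have h2 : Tendsto (fun n => (hk n).compLp (hk0 n) (H1fn (w n))
        - (hk n).compLp (hk0 n) (H1fn w')) atTop (𝓝 0) := by
      refine squeeze_zero_norm (fun n => (hk n).norm_compLp_sub_le (hk0 n) _ _) ?_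
      simpa using (hlim.sub_const (H1fn w')).norm.const_mul (L : ℝ)
    simpa using h2.add h1
  have hdiff : Tendsto (fun n => (p n).z - (hk n).compLp (hk0 n) (H1fn (w n))) atTop (𝓝 0) := by
    rw [tendsto_zero_iff_norm_tendsto_zero]
    have hsq : Tendsto (fun n => ‖(p n).z - (hk n).compLp (hk0 n) (H1fn (w n))‖ ^ 2) atTop
        (𝓝 0) := by
      refine squeeze_zero (fun n => by positivity) (g := fun n =>
        2 * ε n ^ 2 * (c + (a * Ω.vol.real univ + β * ‖H1fn (w n)‖ ^ 2))) (fun n => ?_) ?_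
      · obtain ⟨t, ht0, -, ht⟩ := energyGL_add_coe_le hF ha hβ hFa (hEn n)
        have hr : 1 / (2 * ε n ^ 2) * ‖(p n).z - (hk n).compLp (hk0 n) (H1fn (w n))‖ ^ 2
            ≤ c + (a * Ω.vol.real univ + β * ‖H1fn (w n)‖ ^ 2) := by
          linarith [sq_nonneg ‖H1grad (w n)‖]
        have := hε0 n
        rwa [one_div, inv_mul_le_iff₀ (by positivity)] at hr
      · simpa using ((hε.pow 2).const_mul 2).mul
          ((((hlim.norm.pow 2).const_mul β).const_add (a * Ω.vol.real univ)).const_add c)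
    simpa using hsq.sqrt
  have hzK : q.z = hK.compLp hK0 (H1fn w') :=
    sub_eq_zero.1 (tendsto_nhds_unique (hz.sub hkw) hdiff)
  have hae : ∀ᵐ x ∂Ω.vol, q.z x = K (H1fn w' x) := by
    rw [hzK]
    exact hK.coeFn_compLp hK0 (H1fn w')
  rw [energyZero_eq hw' hqw' hae]
  exact energyGL_le_of_tendsto hF ha hβ hFa hGL (hlim.mono_left hU) hUg

/-- The recovery sequence keeps `u` and replaces `z` by `K_ε(u)`. -/
theorem exists_recovery {F K : ℝ → ℝ} {k : ℝ → ℝ → ℝ} {L : ℝ → ℝ≥0} {L' : ℝ≥0}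
    (hk : ∀ ε, LipschitzWith (L ε) (k ε)) (hk0 : ∀ ε, k ε 0 = 0) (hK : LipschitzWith L' K)
    (hK0 : K 0 = 0) (hkK : ∀ δ > 0, ∀ᶠ ε in 𝓝[>] 0, ∀ s, |k ε s - K s| ≤ δ * |s|)
    (q : State Ω m) :
    ∃ p : ℝ → State Ω m, ConvergesTo p q ∧
      limsup (fun ε => energyEps F (k ε) ε (p ε)) (𝓝[>] 0) ≤ energyZero F K q := by
  by_cases h : ∃ w : H1 Ω, HasMean m w ∧ q.u = toDual (H1fn w) ∧
      ∀ᵐ x ∂Ω.vol, q.z x = K (H1fn w x)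
  · obtain ⟨w, hw, hqw, hz⟩ := h
    let p : ℝ → State Ω m := fun ε => ⟨q.u, (hk ε).compLp (hk0 ε) (H1fn w), q.mass⟩
    refine ⟨p, ?_, ?_⟩
    · have hzK : q.z = hK.compLp hK0 (H1fn w) := by
        refine Lp.ext ?_
        filter_upwards [hz, hK.coeFn_compLp hK0 (H1fn w)] with x h1 h2
        rw [h1, h2, Function.comp_apply]
      rw [ConvergesTo]
      refine Tendsto.congr (fun ε => (edistance_of_u_eq (p := p ε) (q := q) rfl).symm) ?_
      have := tendsto_compLp hk hk0 hK hK0 hkK (H1fn w)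
      rw [← hzK, tendsto_iff_edist_tendsto_0] at this
      simpa only [edist_eq_enorm_sub] using this
    · rw [energyZero_eq hw hqw hz]
      have : ∀ ε, energyEps F (k ε) ε (p ε) = energyGL F w := fun ε => by
        rw [energyEps_eq (p := p ε) hw hqw, integral_sub_sq_eq (hk ε) (hk0 ε)]
        simp [p]
      simp only [this, limsup_const, le_refl]
  · refine ⟨fun _ => q, ?_, ?_⟩
    · rw [ConvergesTo]
      refine tendsto_const_nhds.congr fun ε => ?_
      rw [edistance_of_u_eq rfl, sub_self, enorm_zero]
    · rw [energyZero, dif_neg h]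
      exact le_top

end ViscoPhase

open ViscoPhase in
theorem proposition4p2 {d : ℕ} (hd : 1 ≤ d ∧ d ≤ 3) (Ω : BoundedDomain d)
    (hΩ : Convex ℝ Ω.carrier ∨ HasC11Boundary Ω.carrier) (m : ℝ)
    (F : ℝ → ℝ) (hF : ContDiff ℝ 2 F)
    (β : ℝ) (hβ : 0 < β) (hFβ : ∀ s, -β ≤ deriv (deriv F) s)
    (hgrowth2 : d = 2 → ∃ c p : ℝ, 0 < c ∧ 1 ≤ p ∧ ∀ s, |deriv F s| ≤ c * (|s| ^ p + 1))
    (hgrowth3 : d = 3 → ∃ c p : ℝ, 0 < c ∧ 1 ≤ p ∧ p ≤ 5 ∧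
      ∀ s, |deriv F s| ≤ c * (|s| ^ p + 1))
    (Ahat : ℝ → ℝ → ℝ) (A : ℝ → ℝ)
    (hAhat : ∀ ε ∈ Set.Ioo (0 : ℝ) 1, IsW1Inf (Ahat ε)) (hA : IsW1Inf A)
    (hconv : TendstoUniformly (fun ε s => ε * Ahat ε s) A (𝓝[>] 0))
    (Alow Aup : ℝ) (hAlow : 0 < Alow) (hAup : 0 < Aup)
    (hbound : ∀ ε ∈ Set.Ioo (0 : ℝ) 1, ∀ s, Alow ≤ ε * Ahat ε s ∧ ε * Ahat ε s ≤ Aup) :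
    GammaConverges (Ω := Ω) (m := m)
        (fun ε => energyEps F (fun s => ε * primitive (Ahat ε) s) ε)
        (energyZero F (primitive A)) ∧
      ((∀ s, 0 ≤ F s) → ∀ p : State Ω m, 0 ≤ energyZero F (primitive A) p) := by
  obtain ⟨a, ha, hFa⟩ := exists_neg_quadratic_le hF hβ hFβ
  have hI : ∀ᶠ ε : ℝ in 𝓝[>] 0, ε ∈ Set.Ioo (0 : ℝ) 1 := Ioo_mem_nhdsGT one_pos
  -- Outside `(0, 1)` nothing is known about `Ahat ε`, and `K_ε` is replaced by `0` there.
  let k : ℝ → ℝ → ℝ := fun ε => open Classical in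
    if ε ∈ Set.Ioo (0 : ℝ) 1 then fun s => ε * primitive (Ahat ε) s else 0
  have hkI : ∀ ε ∈ Set.Ioo (0 : ℝ) 1, k ε = fun s => ε * primitive (Ahat ε) s :=
    fun ε hε => if_pos hε
  have hk : ∀ ε, LipschitzWith Aup.toNNReal (k ε) := fun ε => by
    by_cases hε : ε ∈ Set.Ioo (0 : ℝ) 1
    · rw [hkI ε hε]
      refine lipschitzWith_const_mul_primitive (hAhat ε hε) fun s => ?_
      rw [Real.coe_toNNReal _ hAup.le, abs_of_pos (hAlow.trans_le (hbound ε hε s).1)]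
      exact (hbound ε hε s).2
    · rw [show k ε = 0 from if_neg hε]
      exact (LipschitzWith.const (0 : ℝ)).weaken zero_le
  have hk0 : ∀ ε, k ε 0 = 0 := fun ε => by
    by_cases hε : ε ∈ Set.Ioo (0 : ℝ) 1
    · simp only [hkI ε hε, primitive_zero, mul_zero]
    · rw [show k ε = 0 from if_neg hε, Pi.zero_apply]
  obtain ⟨C, hC⟩ := hA.1
  have hK : LipschitzWith C.toNNReal (primitive A) := by
    simpa using lipschitzWith_const_mul_primitive (c := 1) (L := C.toNNReal) hA fun s => by
      rw [one_mul]
      exact (hC s).trans (Real.le_coe_toNNReal C)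
  have hkK : ∀ δ > 0, ∀ᶠ ε in 𝓝[>] (0 : ℝ), ∀ s, |k ε s - primitive A s| ≤ δ * |s| :=
    fun δ hδ => by
      filter_upwards [hI, Metric.tendstoUniformly_iff.1 hconv δ hδ] with ε hε h s
      rw [hkI ε hε]
      refine abs_const_mul_primitive_sub_le (hAhat ε hε) hA (fun t => ?_) s
      rw [← Real.dist_eq, dist_comm]
      exact (h t).le
  refine ⟨⟨fun p q hpq => ?_, fun q => ?_⟩, fun hF0 => energyZero_nonneg hF0⟩
  · refine le_of_forall_gt_imp_ge_of_dense fun b hb => ?_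
    obtain ⟨c, hc, hcb⟩ := EReal.lt_iff_exists_real_btwn.1 hb
    refine le_trans ?_ hcb.le
    have hfin : ∀ᶠ ε in 𝓝[>] (0 : ℝ), avDualNorm ((p ε).u - q.u) ≠ ⊤ := by
      filter_upwards [hpq.eventually (gt_mem_nhds ENNReal.zero_lt_top)] with ε hε
      exact ((avDualNorm_le_edistance _ _).trans_lt hε).ne
    obtain ⟨ε, hε, hεp⟩ := exists_seq_forall_of_frequently
      ((frequently_lt_of_liminf_lt (by isBoundedDefault) hc).and_eventually (hI.and hfin))
    refine energyZero_le_of_seq (k := fun n => k (ε n)) hF.continuous ha hβ.le hFa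
      (hpq.comp hε) (fun n => (hεp n).2.2) (fun n => (hεp n).2.1.1)
      (tendsto_nhds_of_tendsto_nhdsWithin hε) (fun n => hk _) (fun n => hk0 _) hK
      (primitive_zero A) (fun δ hδ => hε.eventually (hkK δ hδ)) fun n => ?_
    rw [hkI _ (hεp n).2.1]
    exact (hεp n).1.le
  · obtain ⟨p, hp, hlim⟩ := exists_recovery (F := F) hk hk0 hK (primitive_zero A) hkK q
    refine ⟨p, hp, (limsup_congr ?_).trans_le hlim⟩
    filter_upwards [hI] with ε hε
    rw [hkI ε hε]
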